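/- Let $m\ge 2$, $k\ge 1$, $n\ge 1$ be integers. For a real or complex tensor $\mathcal T=(t_{i_1\cdots i_p})$ of order $p\ge 1$ and dimension $n$, put $r_i(\mathcal T)=\sum_{i_2,\dots,i_p=1}^{n}|t_{ii_2\cdots i_p}|$ for $i\in[n]=\{1,\dots,n\}$ (so $r_i(\mathcal T)=|t_i|$ if $p=1$). Let $\mathcal A=(a_{i_1\cdots i_m})$ and $\mathcal B=(b_{i_1\cdots i_k})$ be tensors of orders $m$ and $k$, both of dimension $n$, with nonnegative real entries, and suppose that $r_i(\mathcal B)\neq 0$ for all $i\in[n]$. Let $\mathcal A\mathcal B$ be their general product, the tensor of order $(m-1)(k-1)+1$ and dimension $n$ with entries $$c_{i\alpha_1\cdots\alpha_{m-1}}=\sum_{i_2,\dots,i_m=1}^{n}a_{ii_2\cdots i_m}\,b_{i_2\alpha_1}\cdots b_{i_m\alpha_{m-1}},\qquad i\in[n],\ \alpha_1,\dots,\alpha_{m-1}\in[n]^{k-1}.$$ Let $\sigma(\mathcal A)$ be the set of eigenvalues of $\mathcal A$, that is, of all $\lambda\in\mathbb C$ for which there is a nonzero $x\in\mathbb C^n$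 with $\sum_{i_2,\dots,i_m=1}^{n}a_{ii_2\cdots i_m}x_{i_2}\cdots x_{i_m}=\lambda x_i^{m-1}$ for all $i\in[n]$. Then the spectral radius $\rho(\mathcal A)=\max\{|\lambda|:\lambda\in\sigma(\mathcal A)\}$ is well defined (the maximum exists), and $$\min_{i\in[n]}\frac{r_i(\mathcal A\mathcal B)}{(r_i(\mathcal B))^{m-1}}\ \le\ \rho(\mathcal A)\ \le\ \max_{i\in[n]}\frac{r_i(\mathcal A\mathcal B)}{(r_i(\mathcal B))^{m-1}}.$$ -/

import Mathlib

/-- Tensors of order `m ≥ 1` and dimension `n` with entries in `R`. The first index is separated from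
the remaining `m - 1` ones: the entry `a_{i i₂ ⋯ i_m}` is `A i j` with `j = (i₂, …, i_m)`. -/
abbrev HTensor (R : Type*) (m n : ℕ) : Type _ :=
  Fin n → (Fin (m - 1) → Fin n) → R

namespace HTensor

/-- The entrywise order: all entries of a real tensor are nonnegative. -/
def IsNonneg {m n : ℕ} (A : HTensor ℝ m n) : Prop :=
  ∀ i j, 0 ≤ A i j

/-- The `i`-th row sum `r_i(A) = ∑_{i₂, …, i_m} |a_{i i₂ ⋯ i_m}|`. -/
noncomputable def rowSum {R : Type*} [Norm R] {m n : ℕ} (A : HTensor R m n) (i : Fin n) : ℝ :=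
  ∑ j : Fin (m - 1) → Fin n, ‖A i j‖

/-- Shao's general product of a tensor of order `m` and a tensor of order `k`, a tensor of order
`(m - 1) (k - 1) + 1` with entries
`c_{i α₁ ⋯ α_{m-1}} = ∑_{i₂, …, i_m} a_{i i₂ ⋯ i_m} b_{i₂ α₁} ⋯ b_{i_m α_{m-1}}`.
The `(m - 1) (k - 1)` trailing indices of the product form `m - 1` consecutive blocks
`α₁, …, α_{m-1}` of length `k - 1`; index `t` of block `s` (counted from 0) is at position
`finProdFinEquiv (s, t) = t + (k - 1) * s`. -/
def generalProduct {R : Type*} [CommSemiring R] {m k n : ℕ}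
    (A : HTensor R m n) (B : HTensor R k n) : HTensor R ((m - 1) * (k - 1) + 1) n :=
  fun i α => ∑ j : Fin (m - 1) → Fin n,
    A i j * ∏ s : Fin (m - 1), B (j s) (fun t : Fin (k - 1) => α (finProdFinEquiv (s, t)))

/-- The vector `A x^{m-1}`, with components `∑_{i₂, …, i_m} a_{i i₂ ⋯ i_m} x_{i₂} ⋯ x_{i_m}`. -/
def apply {R : Type*} [CommSemiring R] {m n : ℕ} (A : HTensor R m n) (x : Fin n → R) : Fin n → R :=
  fun i => ∑ j : Fin (m - 1) → Fin n, A i j * ∏ s : Fin (m - 1), x (j s)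

/-- A real tensor regarded as a complex tensor. -/
def toComplex {m n : ℕ} (A : HTensor ℝ m n) : HTensor ℂ m n :=
  fun i j => (A i j : ℂ)

/-- The set `σ(A)` of eigenvalues: complex `z` such that `A x^{m-1} = z x^{[m-1]}` for some
nonzero complex vector `x`. -/
def eigenvalues {m n : ℕ} (A : HTensor ℂ m n) : Set ℂ :=
  {z | ∃ x : Fin n → ℂ, x ≠ 0 ∧ ∀ i, apply A x i = z * x i ^ (m - 1)}

/-- The spectral radius `ρ(A)`, the largest modulus of an eigenvalue. -/
noncomputable def spectralRadius {m n : ℕ} (A : HTensor ℂ m n) : ℝ :=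
  sSup ((fun z : ℂ => ‖z‖) '' eigenvalues A)

end HTensor

/-! Put `y = rowSum B`, a positive vector. By nonnegativity the row sums of the product are the
components of `A y^{m-1}`, so the theorem is a Collatz–Wielandt bound for `A` at `y`. Upper bound:
an eigenpair `(z, x)` satisfies `‖z‖ |x|^{[m-1]} ≤ A |x|^{m-1}`. Where `|x i| / y i` attains its
maximum `t`, the vector `|x| ≤ t y` has equality, and monotonicity gives the bound
(`exists_mul_pow_le_apply`). Lower bound: the minimum ratio `c` satisfies `c y^{[m-1]} ≤ A y^{m-1}`,
and `exists_eigenpair` turns this into a real eigenvalue at least `c`. For positive `A` it is the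
largest subeigenvalue; in general, perturb `A` and use compactness. -/

namespace HTensor

/-! ### Monotonicity, homogeneity and row sums -/

section Basic

variable {m n : ℕ}

lemma apply_mono {A : HTensor ℝ m n} (hA : IsNonneg A) {x y : Fin n → ℝ}
    (hx : ∀ i, 0 ≤ x i) (hxy : ∀ i, x i ≤ y i) (i : Fin n) : apply A x i ≤ apply A y i := by
  unfold apply
  exact Finset.sum_le_sum fun j _ => mul_le_mul_of_nonneg_left
    (Finset.prod_le_prod (fun s _ => hx _) fun s _ => hxy _) (hA i j)

lemma apply_nonneg {A : HTensor ℝ m n} (hA : IsNonneg A) {x : Fin n → ℝ}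
    (hx : ∀ i, 0 ≤ x i) (i : Fin n) : 0 ≤ apply A x i := by
  unfold apply
  exact Finset.sum_nonneg fun j _ => mul_nonneg (hA i j) (Finset.prod_nonneg fun s _ => hx _)

lemma apply_smul {R : Type*} [CommSemiring R] (A : HTensor R m n) (c : R) (x : Fin n → R)
    (i : Fin n) : apply A (fun i => c * x i) i = c ^ (m - 1) * apply A x i := by
  simp only [apply, Finset.prod_mul_distrib, Finset.prod_const, Finset.card_univ,
    Fintype.card_fin, Finset.mul_sum]
  exact Finset.sum_congr rfl fun j _ => by ring

lemma continuous_apply {R : Type*} [CommSemiring R] [TopologicalSpace R] [ContinuousAdd R]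
    [ContinuousMul R] (A : HTensor R m n) (i : Fin n) :
    Continuous fun x : Fin n → R => apply A x i := by
  unfold apply
  fun_prop

/-- For an entrywise positive tensor, `x ↦ A x^{m-1}` is strictly increasing in the strong sense. -/
lemma apply_strictMono (hm : 2 ≤ m) {A : HTensor ℝ m n} (hA : ∀ i j, 0 < A i j)
    {x y : Fin n → ℝ} (hx : ∀ i, 0 ≤ x i) (hxy : ∀ i, x i ≤ y i) {l : Fin n} (hl : x l < y l)
    (i : Fin n) : apply A x i < apply A y i := by
  unfold apply
  refine Finset.sum_lt_sum (fun j _ => mul_le_mul_of_nonneg_left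
    (Finset.prod_le_prod (fun s _ => hx _) fun s _ => hxy _) (hA i j).le)
    ⟨fun _ => l, Finset.mem_univ _, mul_lt_mul_of_pos_left ?_ (hA i _)⟩
  simpa using pow_lt_pow_left₀ hl (hx l) (by omega)

lemma norm_apply_toComplex_le {A : HTensor ℝ m n} (hA : IsNonneg A) (x : Fin n → ℂ) (i : Fin n) :
    ‖apply (toComplex A) x i‖ ≤ apply A (fun i => ‖x i‖) i := by
  unfold apply toComplex
  refine (norm_sum_le _ _).trans (Finset.sum_le_sum fun j _ => ?_)
  simp [abs_of_nonneg (hA i j)]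

lemma apply_toComplex_ofReal (A : HTensor ℝ m n) (x : Fin n → ℝ) (i : Fin n) :
    apply (toComplex A) (fun i => (x i : ℂ)) i = ((apply A x i : ℝ) : ℂ) := by
  simp [apply, toComplex]

/-- Comparison of a subeigenvector with a positive vector at the index maximizing the ratio. -/
lemma exists_mul_pow_le_apply {A : HTensor ℝ m n} (hA : IsNonneg A)
    {x y : Fin n → ℝ} (hx : ∀ i, 0 ≤ x i) {l : Fin n} (hl : x l ≠ 0) (hy : ∀ i, 0 < y i) {μ : ℝ}
    (h : ∀ i, μ * x i ^ (m - 1) ≤ apply A x i) :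
    ∃ i, μ * y i ^ (m - 1) ≤ apply A y i := by
  have : Nonempty (Fin n) := ⟨l⟩
  obtain ⟨i, hi⟩ := Finite.exists_max fun i => x i / y i
  set t := x i / y i with ht
  have htpos : 0 < t :=
    (div_pos ((hx l).lt_of_ne' hl) (hy l)).trans_le (hi l)
  have hxi : x i = t * y i := by rw [ht, div_mul_cancel₀ _ (hy i).ne']
  refine ⟨i, le_of_mul_le_mul_left ?_ (pow_pos htpos (m - 1))⟩
  rw [← apply_smul]
  calc t ^ (m - 1) * (μ * y i ^ (m - 1)) = μ * x i ^ (m - 1) := by rw [hxi, mul_pow]; ring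
    _ ≤ apply A x i := h i
    _ ≤ _ := apply_mono hA hx (fun j => (div_le_iff₀ (hy j)).1 (hi j)) i

lemma le_sum_apply_one {A : HTensor ℝ m n} (hA : IsNonneg A)
    {x : Fin n → ℝ} (hx : ∀ i, 0 ≤ x i) {l : Fin n} (hl : x l ≠ 0) {μ : ℝ}
    (h : ∀ i, μ * x i ^ (m - 1) ≤ apply A x i) : μ ≤ ∑ i, apply A (fun _ => 1) i := by
  obtain ⟨i, hi⟩ := exists_mul_pow_le_apply hA hx hl (y := fun _ => 1) (fun _ => one_pos) h
  simp only [one_pow, mul_one] at hi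
  exact hi.trans (Finset.single_le_sum
    (fun i _ => apply_nonneg hA (fun _ => zero_le_one) i) (Finset.mem_univ i))

/-- With no cancellation, absolute values drop out; summing over the independent blocks `α₁, …,
α_{m-1}` factors the product of entries of `B` into row sums. -/
lemma rowSum_generalProduct {k : ℕ} {A : HTensor ℝ m n} {B : HTensor ℝ k n} (hA : IsNonneg A)
    (hB : IsNonneg B) (i : Fin n) :
    rowSum (generalProduct A B) i = apply A (rowSum B) i := by
  have hnn : ∀ (α : Fin ((m - 1) * (k - 1)) → Fin n) (j : Fin (m - 1) → Fin n),
      0 ≤ A i j * ∏ s, B (j s) (fun t => α (finProdFinEquiv (s, t))) := fun α j =>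
    mul_nonneg (hA i j) (Finset.prod_nonneg fun s _ => hB _ _)
  let e : (Fin ((m - 1) * (k - 1)) → Fin n) ≃ (Fin (m - 1) → Fin (k - 1) → Fin n) :=
    (Equiv.arrowCongr finProdFinEquiv.symm (Equiv.refl _)).trans (Equiv.curry _ _ _)
  calc rowSum (generalProduct A B) i
      = ∑ α : Fin ((m - 1) * (k - 1)) → Fin n, ∑ j : Fin (m - 1) → Fin n,
          A i j * ∏ s, B (j s) (fun t => α (finProdFinEquiv (s, t))) :=
        Finset.sum_congr rfl fun α _ =>
          Real.norm_of_nonneg (Finset.sum_nonneg fun j _ => hnn α j)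
    _ = ∑ j : Fin (m - 1) → Fin n, A i j *
          ∑ α : Fin ((m - 1) * (k - 1)) → Fin n, ∏ s, B (j s) (e α s) := by
        rw [Finset.sum_comm]
        exact Finset.sum_congr rfl fun j _ => (Finset.mul_sum _ _ _).symm
    _ = apply A (rowSum B) i := by
        refine Finset.sum_congr rfl fun j _ => ?_
        rw [Equiv.sum_comp e fun β => ∏ s, B (j s) (β s),
          ← Fintype.prod_sum (fun s (β : Fin (k - 1) → Fin n) => B (j s) β)]
        simp only [rowSum, Real.norm_of_nonneg (hB _ _)]

end Basic

/-! ### Weak Perron–Frobenius theorem -/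

section Perron

variable {m n : ℕ}

lemma exists_ne_zero_of_mem_stdSimplex {x : Fin n → ℝ} (hx : x ∈ stdSimplex ℝ (Fin n)) :
    ∃ l, x l ≠ 0 := by
  by_contra! h
  simpa [h] using hx.2

/-- A subeigenvalue with a nonnegative subeigenvector can be realized on the simplex. -/
lemma exists_mem_stdSimplex_mul_pow_le (A : HTensor ℝ m n)
    {x : Fin n → ℝ} (hx : ∀ i, 0 ≤ x i) {l : Fin n} (hl : x l ≠ 0) {μ : ℝ}
    (h : ∀ i, μ * x i ^ (m - 1) ≤ apply A x i) :
    ∃ y ∈ stdSimplex ℝ (Fin n), ∀ i, μ * y i ^ (m - 1) ≤ apply A y i := by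
  have hs : 0 < ∑ i, x i := Finset.sum_pos' (fun i _ => hx i)
    ⟨l, Finset.mem_univ l, (hx l).lt_of_ne' hl⟩
  refine ⟨fun i => (∑ i, x i)⁻¹ * x i,
    ⟨fun i => mul_nonneg (inv_nonneg.2 hs.le) (hx i), ?_⟩, fun i => ?_⟩
  · rw [← Finset.mul_sum, inv_mul_cancel₀ hs.ne']
  · rw [apply_smul, mul_pow, mul_left_comm]
    exact mul_le_mul_of_nonneg_left (h i) (pow_nonneg (inv_nonneg.2 hs.le) _)

/-- An entrywise positive tensor has a nonnegative eigenvector whose eigenvalue dominates all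
Collatz–Wielandt lower bounds. -/
lemma exists_eigenpair_of_pos (hm : 2 ≤ m) {A : HTensor ℝ m n} (hA : ∀ i j, 0 < A i j)
    {y : Fin n → ℝ} (hy : ∀ i, 0 ≤ y i) {l : Fin n} (hl : y l ≠ 0) {c : ℝ} (hc : 0 ≤ c)
    (h : ∀ i, c * y i ^ (m - 1) ≤ apply A y i) :
    ∃ x ∈ stdSimplex ℝ (Fin n), ∃ μ, c ≤ μ ∧ ∀ i, apply A x i = μ * x i ^ (m - 1) := by
  have hA' : IsNonneg A := fun i j => (hA i j).le
  have hd : m - 1 ≠ 0 := by omega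
  set C := ∑ i, apply A (fun _ => 1) i
  let K : Set ((Fin n → ℝ) × ℝ) := (stdSimplex ℝ (Fin n) ×ˢ Set.Icc 0 C) ∩
    {p | ∀ i, p.2 * p.1 i ^ (m - 1) ≤ apply A p.1 i}
  have hmem : ∀ {x : Fin n → ℝ} {μ : ℝ}, (∀ i, 0 ≤ x i) → (∃ l, x l ≠ 0) → 0 ≤ μ →
      (∀ i, μ * x i ^ (m - 1) ≤ apply A x i) → ∃ z, (z, μ) ∈ K := by
    rintro x μ hx ⟨l, hl⟩ hμ hle
    obtain ⟨z, hz, hz'⟩ := exists_mem_stdSimplex_mul_pow_le A hx hl hle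
    exact ⟨z, ⟨hz, hμ, le_sum_apply_one hA' hx hl hle⟩, hz'⟩
  have hK : IsCompact K := by
    refine ((isCompact_stdSimplex ℝ (Fin n)).prod isCompact_Icc).inter_right ?_
    simp only [Set.ofPred_forall]
    exact isClosed_iInter fun i => isClosed_le (by fun_prop)
      ((continuous_apply A i).comp continuous_fst)
  obtain ⟨y', hy'⟩ := hmem hy ⟨l, hl⟩ hc h
  obtain ⟨⟨x, μ⟩, hxK, hmax⟩ := hK.exists_isMaxOn ⟨_, hy'⟩ continuous_snd.continuousOn
  obtain ⟨⟨hx, hμ⟩, hle⟩ := hxK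
  simp only at hx hμ
  change ∀ i, μ * x i ^ (m - 1) ≤ apply A x i at hle
  refine ⟨x, hx, μ, hmax hy', ?_⟩
  -- If equality fails somewhere, a better vector with a larger subeigenvalue exists, against the
  -- maximality of `μ`.
  by_contra! hne
  obtain ⟨l', hl'⟩ := hne
  have hlt : μ * x l' ^ (m - 1) < apply A x l' := (hle l').lt_of_ne' hl'
  obtain ⟨a, ha⟩ := exists_ne_zero_of_mem_stdSimplex hx
  have hApos : ∀ i, 0 < apply A x i := fun i => by
    have := apply_strictMono hm hA (x := fun _ => 0) (y := x) (fun _ => le_rfl) hx.1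
      ((hx.1 a).lt_of_ne' ha) i
    exact (apply_nonneg hA' (fun _ => le_rfl) i).trans_lt this
  have hroot : ∀ r : ℝ, 0 ≤ r → ∃ s : ℝ, 0 ≤ s ∧ s ^ (m - 1) = r := fun r hr =>
    ⟨r ^ ((m - 1 : ℕ) : ℝ)⁻¹, Real.rpow_nonneg hr _, Real.rpow_inv_natCast_pow hr hd⟩
  obtain ⟨t, ht, rfl⟩ := hroot μ hμ.1
  -- The better vector is `z = (A x^{m-1})^{[1/(m-1)]}`. With `μ = t ^ (m - 1)`, it satisfies `t x ≤
  -- z`, strictly at `l'`, so positivity of `A` makes the inequality for `z` strict in every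
  -- component.
  choose z hz hzA using fun i => hroot (apply A x i) (hApos i).le
  have hzpos : ∀ i, 0 < z i := fun i => (hz i).lt_of_ne' fun h0 => by
    have := hApos i
    rw [← hzA, h0, zero_pow hd] at this
    exact this.false
  have hstrict : ∀ i, t ^ (m - 1) * z i ^ (m - 1) < apply A z i := fun i => by
    rw [hzA, ← apply_smul]
    refine apply_strictMono hm hA (fun j => mul_nonneg ht (hx.1 j)) (fun j => ?_) (l := l') ?_ i
    · refine le_of_pow_le_pow_left₀ hd (hz j) ?_
      rw [mul_pow, hzA]
      exact hle j
    · refine lt_of_pow_lt_pow_left₀ (m - 1) (hz l') ?_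
      rwa [mul_pow, hzA]
  have : Nonempty (Fin n) := ⟨a⟩
  obtain ⟨i, hi⟩ := Finite.exists_min fun i => apply A z i / z i ^ (m - 1)
  have hlt' : t ^ (m - 1) < apply A z i / z i ^ (m - 1) :=
    (lt_div_iff₀ (pow_pos (hzpos i) _)).2 (hstrict i)
  obtain ⟨w, hw⟩ := hmem hz ⟨a, (hzpos a).ne'⟩ (hμ.1.trans hlt'.le)
    fun j => (le_div_iff₀ (pow_pos (hzpos j) _)).1 (hi j)
  exact (hmax hw).not_gt hlt'

/-- **Weak Perron–Frobenius theorem** for nonnegative tensors. -/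
lemma exists_eigenpair (hm : 2 ≤ m) {A : HTensor ℝ m n} (hA : IsNonneg A)
    {y : Fin n → ℝ} (hy : ∀ i, 0 ≤ y i) {l : Fin n} (hl : y l ≠ 0) {c : ℝ} (hc : 0 ≤ c)
    (h : ∀ i, c * y i ^ (m - 1) ≤ apply A y i) :
    ∃ x ∈ stdSimplex ℝ (Fin n), ∃ μ, c ≤ μ ∧ ∀ i, apply A x i = μ * x i ^ (m - 1) := by
  let E : HTensor ℝ m n := fun _ _ => 1
  have hE : IsNonneg E := fun _ _ => zero_le_one
  have hadd : ∀ (ε : ℝ) (x : Fin n → ℝ) (i : Fin n),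
      apply (fun i j => A i j + ε) x i = apply A x i + ε * apply E x i := fun ε x i => by
    simp only [apply, E, add_mul, Finset.sum_add_distrib, Finset.mul_sum, one_mul]
  set D := ∑ i, apply E (fun _ => 1) i
  -- Since `ε ≤ 1`, this bounds the eigenvalues of all perturbations `A + ε` at once.
  set C := ∑ i, apply (fun i j => A i j + 1) (fun _ => 1) i
  have happrox : ∀ ε : ℝ, 0 < ε → ε ≤ 1 → ∃ x ∈ stdSimplex ℝ (Fin n), ∃ μ ∈ Set.Icc c C,
      ∑ i, |apply A x i - μ * x i ^ (m - 1)| ≤ ε * D := fun ε hε hε1 => by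
    have hEy : ∀ {x : Fin n → ℝ}, (∀ i, 0 ≤ x i) → ∀ i, 0 ≤ apply E x i :=
      fun hx i => apply_nonneg hE hx i
    obtain ⟨x, hx, μ, hcμ, hμ⟩ := exists_eigenpair_of_pos hm (A := fun i j => A i j + ε)
      (fun i j => add_pos_of_nonneg_of_pos (hA i j) hε) hy hl hc fun i => by
        rw [hadd]
        exact (h i).trans (le_add_of_nonneg_right (mul_nonneg hε.le (hEy hy i)))
    obtain ⟨a, ha⟩ := exists_ne_zero_of_mem_stdSimplex hx
    refine ⟨x, hx, μ, ⟨hcμ, le_sum_apply_one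
      (fun i j => add_nonneg (hA i j) zero_le_one) hx.1 ha fun i => ?_⟩, ?_⟩
    · rw [← hμ i, hadd, hadd]
      exact add_le_add_right (mul_le_mul_of_nonneg_right hε1 (hEy hx.1 i)) _
    · rw [Finset.mul_sum]
      refine Finset.sum_le_sum fun i _ => ?_
      rw [← hμ i, hadd, sub_add_cancel_left, abs_neg,
        abs_of_nonneg (mul_nonneg hε.le (hEy hx.1 i))]
      exact mul_le_mul_of_nonneg_left (apply_mono hE hx.1
        (fun j => (mem_Icc_of_mem_stdSimplex hx j).2) i) hε.le
  -- The eigenpair residual attains its minimum on a compact set, and the perturbed eigenpairs make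
  -- it arbitrarily small, so a minimizer is an exact eigenpair.
  let f : (Fin n → ℝ) × ℝ → ℝ := fun p => ∑ i, |apply A p.1 i - p.2 * p.1 i ^ (m - 1)|
  have hf : Continuous f := by
    refine continuous_finsetSum _ fun i _ => Continuous.abs (Continuous.sub ?_ (by fun_prop))
    exact (continuous_apply A i).comp continuous_fst
  obtain ⟨x₁, hx₁, μ₁, hμ₁, -⟩ := happrox 1 one_pos le_rfl
  obtain ⟨⟨x, μ⟩, ⟨hx, hμ⟩, hmin⟩ := ((isCompact_stdSimplex ℝ (Fin n)).prod
    (isCompact_Icc (a := c) (b := C))).exists_isMinOn ⟨(x₁, μ₁), hx₁, hμ₁⟩ hf.continuousOn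
  have hD : 0 ≤ D := Finset.sum_nonneg fun i _ => apply_nonneg hE (fun _ => zero_le_one) i
  have hzero : f (x, μ) ≤ 0 := by
    refine le_of_forall_pos_le_add fun δ hδ => ?_
    have hε : 0 < min 1 (δ / (D + 1)) := lt_min one_pos (by positivity)
    obtain ⟨x', hx', μ', hμ', hle⟩ := happrox _ hε (min_le_left _ _)
    calc f (x, μ) ≤ f (x', μ') := hmin ⟨hx', hμ'⟩
      _ ≤ min 1 (δ / (D + 1)) * D := hle
      _ ≤ δ / (D + 1) * (D + 1) :=
        mul_le_mul (min_le_right _ _) (by linarith) hD (by positivity)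
      _ = 0 + δ := by rw [div_mul_cancel₀ _ (by positivity), zero_add]
  refine ⟨x, hx, μ, hμ.1, fun i => ?_⟩
  have hsum : f (x, μ) = 0 := hzero.antisymm (Finset.sum_nonneg fun i _ => abs_nonneg _)
  have := (Finset.sum_eq_zero_iff_of_nonneg fun i _ => abs_nonneg _).1 hsum i (Finset.mem_univ i)
  exact sub_eq_zero.1 (abs_eq_zero.1 this)

end Perron

/-! ### Complex eigenvalues and the spectral radius -/

section Spectrum

variable {m n : ℕ}

/-- Upper Collatz–Wielandt bound for complex eigenvalues. -/
lemma exists_norm_mul_pow_le_apply {A : HTensor ℝ m n} (hA : IsNonneg A)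
    {y : Fin n → ℝ} (hy : ∀ i, 0 < y i) {z : ℂ} (hz : z ∈ eigenvalues (toComplex A)) :
    ∃ i, ‖z‖ * y i ^ (m - 1) ≤ apply A y i := by
  obtain ⟨x, hx, h⟩ := hz
  obtain ⟨l, hl⟩ := Function.ne_iff.1 hx
  refine exists_mul_pow_le_apply hA (x := fun i => ‖x i‖) (fun i => norm_nonneg _)
    (l := l) (by simpa using hl) hy fun i => ?_
  rw [← norm_pow, ← norm_mul, ← h i]
  exact norm_apply_toComplex_le hA x i

lemma ofReal_mem_eigenvalues {A : HTensor ℝ m n} {x : Fin n → ℝ} {l : Fin n} (hl : x l ≠ 0)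
    {μ : ℝ} (h : ∀ i, apply A x i = μ * x i ^ (m - 1)) :
    (μ : ℂ) ∈ eigenvalues (toComplex A) := by
  refine ⟨fun i => (x i : ℂ), fun h0 => hl ?_, fun i => ?_⟩
  · simpa using congrFun h0 l
  · rw [apply_toComplex_ofReal, h i]
    push_cast
    rfl

/-- Eigenvectors can be scaled to norm one and eigenvalues are bounded, so the spectrum is a
projection of a compact set of eigenpairs. -/
lemma isCompact_eigenvalues {A : HTensor ℝ m n} (hA : IsNonneg A) :
    IsCompact (eigenvalues (toComplex A)) := by
  set C := ∑ i, apply A (fun _ => 1) i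
  let K : Set ((Fin n → ℂ) × ℂ) :=
    (Metric.sphere 0 1 ×ˢ Metric.closedBall 0 C) ∩
      {p | ∀ i, apply (toComplex A) p.1 i = p.2 * p.1 i ^ (m - 1)}
  have hK : IsCompact K := by
    refine ((isCompact_sphere _ _).prod (isCompact_closedBall _ _)).inter_right ?_
    simp only [Set.ofPred_forall]
    exact isClosed_iInter fun i => isClosed_eq
      ((continuous_apply _ i).comp continuous_fst) (by fun_prop)
  convert hK.image continuous_snd
  ext z
  constructor
  · intro hz
    obtain ⟨i, hi⟩ := exists_norm_mul_pow_le_apply hA (y := fun _ => 1) (fun _ => one_pos) hz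
    simp only [one_pow, mul_one] at hi
    have hzC : ‖z‖ ≤ C := hi.trans (Finset.single_le_sum
      (fun i _ => apply_nonneg hA (fun _ => zero_le_one) i) (Finset.mem_univ i))
    obtain ⟨x, hx, h⟩ := hz
    refine ⟨(fun i => ((‖x‖⁻¹ : ℝ) : ℂ) * x i, z), ⟨⟨?_, by simpa using hzC⟩, fun i => ?_⟩, rfl⟩
    · have : (fun i => ((‖x‖⁻¹ : ℝ) : ℂ) * x i) = ((‖x‖⁻¹ : ℝ) : ℂ) • x := rfl
      rw [mem_sphere_zero_iff_norm, this, norm_smul, Complex.norm_real, norm_inv, norm_norm,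
        inv_mul_cancel₀ (norm_ne_zero_iff.2 hx)]
    · change apply _ (fun i => ((‖x‖⁻¹ : ℝ) : ℂ) * x i) i = z * (((‖x‖⁻¹ : ℝ) : ℂ) * x i) ^ (m - 1)
      rw [apply_smul, h i]
      ring
  · rintro ⟨⟨x, z⟩, ⟨⟨hx, -⟩, h⟩, rfl⟩
    refine ⟨x, fun h0 => ?_, h⟩
    simp [h0] at hx

lemma isGreatest_spectralRadius [NeZero n] (hm : 2 ≤ m) {A : HTensor ℝ m n} (hA : IsNonneg A) :
    IsGreatest ((fun z : ℂ => ‖z‖) '' eigenvalues (toComplex A)) (spectralRadius (toComplex A)) := by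
  -- The trivial bound `c = 0` at the all-ones vector suffices for a nonempty spectrum.
  obtain ⟨x, hx, μ, -, h⟩ := exists_eigenpair hm hA (y := fun _ => 1) (fun _ => zero_le_one)
    (l := 0) one_ne_zero le_rfl fun i => by
      rw [zero_mul]
      exact apply_nonneg hA (fun _ => zero_le_one) i
  obtain ⟨l, hl⟩ := exists_ne_zero_of_mem_stdSimplex hx
  exact ((isCompact_eigenvalues hA).image continuous_norm).isGreatest_sSup
    ⟨_, Set.mem_image_of_mem _ (ofReal_mem_eigenvalues hl h)⟩

end Spectrum

end HTensor

/-- The first conjunct says that the maximum in `ρ(A) = max {|z| : z ∈ σ(A)}` exists, so that the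
supremum defining `HTensor.spectralRadius` is this maximum. -/
theorem theorem3p1 {m k n : ℕ} [NeZero n] (hm : 2 ≤ m) (hk : 1 ≤ k)
    (A : HTensor ℝ m n) (B : HTensor ℝ k n)
    (hA : HTensor.IsNonneg A) (hB : HTensor.IsNonneg B)
    (hr : ∀ i : Fin n, HTensor.rowSum B i ≠ 0) :
    IsGreatest ((fun z : ℂ => ‖z‖) '' HTensor.eigenvalues (HTensor.toComplex A))
        (HTensor.spectralRadius (HTensor.toComplex A)) ∧
      Finset.univ.inf' Finset.univ_nonempty
          (fun i : Fin n => HTensor.rowSum (HTensor.generalProduct A B) i /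
            HTensor.rowSum B i ^ (m - 1)) ≤
        HTensor.spectralRadius (HTensor.toComplex A) ∧
      HTensor.spectralRadius (HTensor.toComplex A) ≤
        Finset.univ.sup' Finset.univ_nonempty
          (fun i : Fin n => HTensor.rowSum (HTensor.generalProduct A B) i /
            HTensor.rowSum B i ^ (m - 1)) := by
  have hρ := HTensor.isGreatest_spectralRadius hm hA
  have hy : ∀ i, 0 < HTensor.rowSum B i := fun i =>
    (Finset.sum_nonneg fun _ _ => norm_nonneg _ : 0 ≤ HTensor.rowSum B i).lt_of_ne' (hr i)
  simp only [HTensor.rowSum_generalProduct hA hB]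
  refine ⟨hρ, ?_, ?_⟩
  · set c := Finset.univ.inf' Finset.univ_nonempty
      (fun i : Fin n => HTensor.apply A (HTensor.rowSum B) i / HTensor.rowSum B i ^ (m - 1))
    have hc : 0 ≤ c := Finset.le_inf' _ _ fun i _ =>
      div_nonneg (HTensor.apply_nonneg hA (fun j => (hy j).le) i) (pow_nonneg (hy i).le _)
    obtain ⟨x, hx, μ, hcμ, h⟩ := HTensor.exists_eigenpair hm hA (fun i => (hy i).le)
      (l := 0) (hr 0) hc fun i =>
        (le_div_iff₀ (pow_pos (hy i) _)).1 (Finset.inf'_le _ (Finset.mem_univ i))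
    obtain ⟨l, hl⟩ := HTensor.exists_ne_zero_of_mem_stdSimplex hx
    have := hρ.2 (Set.mem_image_of_mem _ (HTensor.ofReal_mem_eigenvalues hl h))
    rw [Complex.norm_real] at this
    exact hcμ.trans ((le_abs_self μ).trans this)
  · obtain ⟨z, hz, hzρ⟩ := hρ.1
    obtain ⟨i, hi⟩ := HTensor.exists_norm_mul_pow_le_apply hA hy hz
    rw [← hzρ]
    exact ((le_div_iff₀ (pow_pos (hy i) _)).2 hi).trans
      (Finset.le_sup' (fun i : Fin n => HTensor.apply A (HTensor.rowSum B) i /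
        HTensor.rowSum B i ^ (m - 1)) (Finset.mem_univ i))
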